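/- All spaces are Tychonoff (completely regular and Hausdorff). A zero set of a space $X$ is a set $\{x : f(x)=0\}$ with $f : X\to\mathbb R$ continuous. A space is realcompact if every family $\mathcal S$ of its closed subsets that has the finite intersection property and is stable (every continuous real-valued function on the space is bounded on some member of $\mathcal S$) has nonempty intersection; a subset is realcompact if it is so in the subspace topology. Two subsets $A,B$ of $X$ are completely separated if some continuous $f : X\to[0,1]$ is $0$ on $A$ and $1$ on $B$. A subset $H$ of $X$ is hard in $X$ if it is closed in $X$ and there is a compact set $K\subseteq X$ such that for every open $V\supseteq K$ there is a realcompact $P\subseteq X$ for which $H\setminus V$ and $X\setminus P$ are completely separated. A continuous map $f : X\to T$ is an h2pc map if $\operatorname{cl}_T f(H)$ is compact for every hard set $H$ of $X$. A $z$-filter on $X$ is a nonempty family of nonempty zero sets of $X$ that is closed under finite intersections and under zero-set supersets; a $z$-ultrafilter is a maximal $z$-filter, and it is fixed if its members have a common point. An $hz$-filter is a $z$-filter with a base of hard zero sets, and an $hz$-ultrafilter is a maximal $hz$-filter. Let $\delta X$ be the set of all fixed $z$-ultrafilters and all $hz$-ultrafilters on $X$, with the topology for which the sets $\overline Z=\{p\in\delta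 X : Z\in p\}$, $Z$ a zero set of $X$, form a base of closed sets, and identify $x\in X$ with the fixed $z$-ultrafilter $A_x=\{Z : Z \text{ a zero set},\ x\in Z\}\in\delta X$. **Corollary (uniqueness of $\delta X$).** Let $X$ be a dense subspace of a space $Y$ such that 1. for every space $T$, every h2pc map $f : X\to T$ extends to a continuous map $Y\to T$; and 2. $\operatorname{cl}_Y H$ is compact for every hard set $H$ of $X$. Then $Y$ is homeomorphic to $\delta X$ over $X$: there is a homeomorphism $h : Y\to\delta X$ with $h(x)=A_x$ for every $x\in X$. -/

import Mathlib

universe u v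

section Basic

variable {X : Type u} [TopologicalSpace X]

/-- Zero sets of `X`: the sets `{x | f x = 0}` for continuous `f : X → ℝ`. -/
def IsZSet (Z : Set X) : Prop := ∃ f : C(X, ℝ), Z = {x | f x = 0}

/-- A family of subsets of `X` is stable if every real-valued continuous function on `X`
is bounded on some member of the family. -/
def IsStableFamily (S : Set (Set X)) : Prop :=
  ∀ f : C(X, ℝ), ∃ D ∈ S, ∃ M : ℝ, ∀ x ∈ D, |f x| ≤ M

/-- The finite intersection property. -/
def HasFIP (S : Set (Set X)) : Prop :=
  ∀ T : Set (Set X), T ⊆ S → T.Finite → (⋂₀ T).Nonempty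

variable (X) in
/-- A space is realcompact if every stable family of closed sets with the finite intersection
property is fixed, i.e. has nonempty intersection. -/
def IsRealcompactSpace : Prop :=
  ∀ S : Set (Set X), (∀ D ∈ S, IsClosed D) → IsStableFamily S → HasFIP S → (⋂₀ S).Nonempty

/-- A subset is realcompact if it is a realcompact space in the subspace topology. -/
def IsRealcompactSet (P : Set X) : Prop := IsRealcompactSpace P

/-- `A` and `B` are completely separated: some continuous `f : X → [0,1]` is `0` on `A` and
`1` on `B`. -/
def AreCompletelySeparated (A B : Set X) : Prop :=
  ∃ f : C(X, ℝ), (∀ x, 0 ≤ f x ∧ f x ≤ 1) ∧ (∀ x ∈ A, f x = 0) ∧ (∀ x ∈ B, f x = 1)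

/-- Hard subsets of `X`. -/
def IsHard (H : Set X) : Prop :=
  IsClosed H ∧ ∃ K : Set X, IsCompact K ∧ ∀ V : Set X, IsOpen V → K ⊆ V →
    ∃ P : Set X, IsRealcompactSet P ∧ AreCompletelySeparated (H \ V) Pᶜ

/-- An h2pc map: a continuous map that takes hard sets to sets with compact closure. -/
def IsH2pc {Z : Type v} [TopologicalSpace Z] (f : X → Z) : Prop :=
  Continuous f ∧ ∀ H : Set X, IsHard H → IsCompact (closure (f '' H))

/-- A (proper) `z`-filter on `X`. -/
structure IsZFilter (F : Set (Set X)) : Prop where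
  zset : ∀ Z ∈ F, IsZSet Z
  nonempty : F.Nonempty
  empty_notMem : ∅ ∉ F
  inter : ∀ Z ∈ F, ∀ W ∈ F, Z ∩ W ∈ F
  superset : ∀ Z ∈ F, ∀ W, IsZSet W → Z ⊆ W → W ∈ F

/-- A `z`-ultrafilter is a maximal `z`-filter. -/
def IsZUltrafilter (F : Set (Set X)) : Prop := Maximal IsZFilter F

/-- A family of sets is fixed if its members have a common point. -/
def IsFixedFamily (F : Set (Set X)) : Prop := (⋂₀ F).Nonempty

/-- An `hz`-filter is a `z`-filter with a base of hard zero sets. -/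
def IsHZFilter (F : Set (Set X)) : Prop :=
  IsZFilter F ∧ ∀ Z ∈ F, ∃ H ∈ F, IsHard H ∧ H ⊆ Z

/-- An `hz`-ultrafilter is a maximal `hz`-filter. -/
def IsHZUltrafilter (F : Set (Set X)) : Prop := Maximal IsHZFilter F

/-- The family of all zero sets that contain the point `x`. -/
def pointFamily (x : X) : Set (Set X) := {Z | IsZSet Z ∧ x ∈ Z}

theorem isZSet_univ : IsZSet (Set.univ : Set X) := ⟨0, by ext x; simp⟩

theorem IsZSet.inter {Z W : Set X} (hZ : IsZSet Z) (hW : IsZSet W) : IsZSet (Z ∩ W) := by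
  obtain ⟨f, rfl⟩ := hZ
  obtain ⟨g, rfl⟩ := hW
  refine ⟨f * f + g * g, ?_⟩
  ext x
  simp only [Set.mem_inter_iff, Set.mem_ofPred_eq, ContinuousMap.add_apply,
    ContinuousMap.mul_apply]
  exact mul_self_add_mul_self_eq_zero.symm

theorem isZUltrafilter_pointFamily (x : X) : IsZUltrafilter (pointFamily x) := by
  refine ⟨⟨fun Z hZ => hZ.1, ⟨Set.univ, isZSet_univ, trivial⟩, fun h => h.2,
    fun Z hZ W hW => ⟨hZ.1.inter hW.1, hZ.2, hW.2⟩,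
    fun Z hZ W hW h => ⟨hW, h hZ.2⟩⟩, ?_⟩
  intro G hG hle Z hZ
  refine ⟨hG.zset Z hZ, ?_⟩
  by_contra hx
  obtain ⟨f, rfl⟩ := hG.zset Z hZ
  have hW : {y | f y = f x} ∈ G := by
    refine hle ⟨⟨f - ContinuousMap.const X (f x), ?_⟩, rfl⟩
    ext y
    simp [sub_eq_zero]
  refine hG.empty_notMem ?_
  have h := hG.inter _ hZ _ hW
  have he : {y | f y = 0} ∩ {y | f y = f x} = ∅ := by
    ext y
    simp only [Set.mem_inter_iff, Set.mem_ofPred_eq, Set.mem_empty_iff_false, iff_false, not_and]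
    intro h1 h2
    exact hx (h2.symm.trans h1)
  rwa [he] at h

theorem isFixedFamily_pointFamily (x : X) : IsFixedFamily (pointFamily x) :=
  ⟨x, fun _ hZ => hZ.2⟩

end Basic

/-- The underlying set of `δX`: all fixed `z`-ultrafilters and all `hz`-ultrafilters on `X`. -/
def NPDelta (X : Type u) [TopologicalSpace X] : Type u :=
  {p : Set (Set X) // (IsZUltrafilter p ∧ IsFixedFamily p) ∨ IsHZUltrafilter p}

namespace NPDelta

variable {X : Type u} [TopologicalSpace X]

/-- For a zero set `Z`, the set of all `p ∈ δX` with `Z ∈ p`. -/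
def basicClosed (Z : Set X) : Set (NPDelta X) := {p | Z ∈ p.1}

/-- The topology of `δX` whose closed sets are generated by the sets `basicClosed Z`,
`Z` a zero set of `X`. -/
instance : TopologicalSpace (NPDelta X) :=
  TopologicalSpace.generateFrom {U | ∃ Z : Set X, IsZSet Z ∧ U = (basicClosed Z)ᶜ}

/-- The canonical map `X → δX`, which sends `x` to the fixed `z`-ultrafilter of all zero sets
that contain `x`. -/
def incl (x : X) : NPDelta X :=
  ⟨pointFamily x, Or.inl ⟨isZUltrafilter_pointFamily x, isFixedFamily_pointFamily x⟩⟩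

end NPDelta

/-! Both properties assumed of `Y` hold for `δX`, so the inclusions of `X` into `δX` and `Y` are
h2pc and each extends over the other space; the two extensions are mutually inverse, since their
composites are the identity on a dense copy of `X`. Extension: a point of `δX` is fixed or contains
a hard set, whose image has compact closure, so a limit value exists (`exists_tendsto_comap_incl`).
Compactness: an ultrafilter on the closure of a hard set traces a z-filter on `X`; any z-ultrafilter
above the trace is its limit, once known to lie in `δX`. This is
`isHZUltrafilter_of_forall_superset`. -/

open Filter Topology

/-! ### Zero sets and z-ultrafilters. -/

section ZeroSets

variable {X : Type u} [TopologicalSpace X]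

theorem isZSet_le (f : C(X, ℝ)) (a : ℝ) : IsZSet {x | f x ≤ a} := by
  refine ⟨⟨fun x => max (f x - a) 0, by fun_prop⟩, ?_⟩
  ext x
  simp

theorem isZSet_ge (f : C(X, ℝ)) (a : ℝ) : IsZSet {x | a ≤ f x} := by
  simpa using isZSet_le (-f) (-a)

theorem isZSet_empty : IsZSet (∅ : Set X) := ⟨1, by ext x; simp⟩

theorem IsZSet.union {Z W : Set X} (hZ : IsZSet Z) (hW : IsZSet W) : IsZSet (Z ∪ W) := by
  obtain ⟨f, rfl⟩ := hZ
  obtain ⟨g, rfl⟩ := hW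
  exact ⟨f * g, by ext x; simp⟩

theorem IsZSet.isClosed {Z : Set X} (hZ : IsZSet Z) : IsClosed Z := by
  obtain ⟨f, rfl⟩ := hZ
  exact isClosed_eq f.continuous continuous_const

/-- Disjoint zero sets are completely separated. -/
theorem IsZSet.areCompletelySeparated {Z W : Set X} (hZ : IsZSet Z) (hW : IsZSet W)
    (h : Disjoint Z W) : AreCompletelySeparated Z W := by
  obtain ⟨f, rfl⟩ := hZ
  obtain ⟨g, rfl⟩ := hW
  have hpos : ∀ x, 0 < |f x| + |g x| := by
    intro x
    by_contra hx
    have hf := abs_nonneg (f x)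
    have hg := abs_nonneg (g x)
    exact Set.disjoint_left.1 h (abs_eq_zero.1 (by linarith : |f x| = 0))
      (abs_eq_zero.1 (by linarith : |g x| = 0))
  refine ⟨⟨fun x => |f x| / (|f x| + |g x|), ?_⟩, ?_, ?_, ?_⟩
  · exact Continuous.div (by fun_prop) (by fun_prop) fun x => (hpos x).ne'
  · intro x
    refine ⟨div_nonneg (abs_nonneg _) (hpos x).le, ?_⟩
    exact div_le_one_of_le₀ (by linarith [abs_nonneg (g x)]) (hpos x).le
  · intro x hx
    have hx : f x = 0 := hx
    simp [hx]
  · intro x hx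
    have hx' : g x = 0 := hx
    have := hpos x
    simp only [hx', abs_zero, add_zero] at this
    simp [hx', this.ne']

theorem exists_isZSet_of_isOpen [CompletelyRegularSpace X] {U : Set X} (hU : IsOpen U) {x : X}
    (hx : x ∈ U) : ∃ Z : Set X, IsZSet Z ∧ x ∉ Z ∧ Zᶜ ⊆ U := by
  obtain ⟨f, hf, hfx, hfU⟩ := CompletelyRegularSpace.completely_regular x Uᶜ hU.isClosed_compl
    (by simpa using hx)
  refine ⟨_, isZSet_ge ⟨fun y => (f y : ℝ), by fun_prop⟩ 1, ?_, ?_⟩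
  · simp [hfx]
  · intro y hy
    by_contra hyU
    exact hy (by simp [hfU hyU])

theorem IsZFilter.univ_mem {p : Set (Set X)} (hp : IsZFilter p) : Set.univ ∈ p := by
  obtain ⟨Z, hZ⟩ := hp.nonempty
  exact hp.superset Z hZ _ isZSet_univ (Set.subset_univ _)

/-- Otherwise the traces of `p` on `Z` generate a z-filter that contains both `p` and `Z`. -/
theorem IsZUltrafilter.exists_disjoint {p : Set (Set X)} (hp : IsZUltrafilter p) {Z : Set X}
    (hZ : IsZSet Z) (hZp : Z ∉ p) : ∃ W ∈ p, Disjoint W Z := by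
  by_contra! h
  have hG : IsZFilter {W | IsZSet W ∧ ∃ A ∈ p, A ∩ Z ⊆ W} := by
    refine ⟨fun W hW => hW.1, ⟨Set.univ, isZSet_univ, Set.univ, hp.1.univ_mem, Set.subset_univ _⟩,
      ?_, ?_, ?_⟩
    · rintro ⟨-, A, hA, hAZ⟩
      exact h A hA (Set.disjoint_iff.2 hAZ)
    · rintro W ⟨hW, A, hA, hAW⟩ W' ⟨hW', A', hA', hAW'⟩
      exact ⟨hW.inter hW', A ∩ A', hp.1.inter A hA A' hA',
        fun x hx => ⟨hAW ⟨hx.1.1, hx.2⟩, hAW' ⟨hx.1.2, hx.2⟩⟩⟩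
    · rintro W ⟨-, A, hA, hAW⟩ W' hW' hWW'
      exact ⟨hW', A, hA, hAW.trans hWW'⟩
  refine hZp (hp.2 hG ?_ ⟨hZ, Set.univ, hp.1.univ_mem, by simp⟩)
  exact fun W hW => ⟨hp.1.zset W hW, W, hW, Set.inter_subset_left⟩

theorem IsZUltrafilter.union_mem {p : Set (Set X)} (hp : IsZUltrafilter p) {Z W : Set X}
    (hZ : IsZSet Z) (hW : IsZSet W) (h : Z ∪ W ∈ p) : Z ∈ p ∨ W ∈ p := by
  by_contra! hn
  obtain ⟨A, hA, hAZ⟩ := hp.exists_disjoint hZ hn.1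
  obtain ⟨B, hB, hBW⟩ := hp.exists_disjoint hW hn.2
  refine hp.1.empty_notMem ?_
  convert hp.1.inter _ h _ (hp.1.inter A hA B hB)
  symm
  rw [Set.eq_empty_iff_forall_notMem]
  rintro x ⟨hx | hx, hxA, hxB⟩
  · exact Set.disjoint_left.1 hAZ hxA hx
  · exact Set.disjoint_left.1 hBW hxB hx

/-- Every `z`-filter is contained in a `z`-ultrafilter. -/
theorem IsZFilter.exists_le_isZUltrafilter {q : Set (Set X)} (hq : IsZFilter q) :
    ∃ p, q ⊆ p ∧ IsZUltrafilter p := by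
  refine zorn_subset_nonempty {q | IsZFilter q} ?_ q hq
  rintro c hc hchain ⟨q₀, hq₀⟩
  refine ⟨⋃₀ c, ?_, fun s hs => Set.subset_sUnion_of_mem hs⟩
  refine ⟨?_, ?_, ?_, ?_, ?_⟩
  · rintro Z ⟨s, hs, hZ⟩
    exact (hc hs).zset Z hZ
  · exact ⟨Set.univ, q₀, hq₀, (hc hq₀).univ_mem⟩
  · rintro ⟨s, hs, h⟩
    exact (hc hs).empty_notMem h
  · rintro Z ⟨s, hs, hZ⟩ W ⟨t, ht, hW⟩
    rcases hchain.total hs ht with h | h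
    · exact ⟨t, ht, (hc ht).inter Z (h hZ) W hW⟩
    · exact ⟨s, hs, (hc hs).inter Z hZ W (h hW)⟩
  · rintro Z ⟨s, hs, hZ⟩ W hW hZW
    exact ⟨s, hs, (hc hs).superset Z hZ W hW hZW⟩

theorem IsZFilter.exists_ultrafilter {p : Set (Set X)} (hp : IsZFilter p) :
    ∃ 𝒰 : Ultrafilter X, ∀ Z ∈ p, Z ∈ 𝒰 := by
  let F : FilterBasis X :=
    { sets := p
      nonempty := hp.nonempty
      inter_sets := fun {Z W} hZ hW => ⟨Z ∩ W, hp.inter Z hZ W hW, subset_rfl⟩ }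
  have : F.filter.NeBot := by
    refine F.hasBasis.neBot_iff.2 ?_
    intro Z hZ
    by_contra h
    rw [Set.not_nonempty_iff_eq_empty] at h
    exact hp.empty_notMem (h ▸ hZ)
  exact ⟨Ultrafilter.of F.filter, fun Z hZ => Ultrafilter.of_le _ (F.hasBasis.mem_of_mem hZ)⟩

end ZeroSets

/-! ### Hard sets and hz-ultrafilters. -/

section Hard

variable {X : Type u} [TopologicalSpace X]

theorem IsHard.of_isClosed_subset {H C : Set X} (hH : IsHard H) (hC : IsClosed C) (h : C ⊆ H) :
    IsHard C := by
  obtain ⟨-, K, hK, hV⟩ := hH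
  refine ⟨hC, K, hK, fun V hVo hKV => ?_⟩
  obtain ⟨P, hP, f, hf, h0, h1⟩ := hV V hVo hKV
  exact ⟨P, hP, f, hf, fun x hx => h0 x ⟨h hx.1, hx.2⟩, h1⟩

theorem IsZFilter.isHZFilter {p : Set (Set X)} (hp : IsZFilter p) {H : Set X} (hH : H ∈ p)
    (hard : IsHard H) : IsHZFilter p :=
  ⟨hp, fun Z hZ => ⟨Z ∩ H, hp.inter Z hZ H hH, hard.of_isClosed_subset
    (hp.zset _ (hp.inter Z hZ H hH)).isClosed Set.inter_subset_right, Set.inter_subset_left⟩⟩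

theorem IsHZUltrafilter.exists_isHard {p : Set (Set X)} (hp : IsHZUltrafilter p) :
    ∃ H ∈ p, IsHard H := by
  obtain ⟨H, hH, hard, -⟩ := hp.1.2 _ hp.1.1.univ_mem
  exact ⟨H, hH, hard⟩

/-- A z-filter with one hard member is already an hz-filter, so maximality means the same in both
classes. -/
theorem IsHZUltrafilter.isZUltrafilter {p : Set (Set X)} (hp : IsHZUltrafilter p) :
    IsZUltrafilter p := by
  obtain ⟨H, hH, hard⟩ := hp.exists_isHard
  exact ⟨hp.1.1, fun G hG hle => hp.2 (hG.isHZFilter (hle hH) hard) hle⟩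

theorem IsZUltrafilter.isHZUltrafilter {p : Set (Set X)} (hp : IsZUltrafilter p) {H : Set X}
    (hH : H ∈ p) (hard : IsHard H) : IsHZUltrafilter p :=
  ⟨hp.1.isHZFilter hH hard, fun _ hG hle => hp.2 hG.1 hle⟩

/-- A compact set which contains no cluster point of a `z`-filter is separated from a member. -/
theorem IsZFilter.exists_one_le_of_isCompact {p : Set (Set X)} (hp : IsZFilter p)
    (hfree : ¬ IsFixedFamily p) {K : Set X} (hK : IsCompact K) :
    ∃ f : C(X, ℝ), {x | f x = 0} ∈ p ∧ ∀ x ∈ K, 1 ≤ |f x| := by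
  refine hK.induction_on (p := fun s => ∃ f : C(X, ℝ), {x | f x = 0} ∈ p ∧ ∀ x ∈ s, 1 ≤ |f x|)
    ?_ ?_ ?_ ?_
  · exact ⟨0, by simpa using hp.univ_mem, by simp⟩
  · rintro s t hst ⟨f, hf, h⟩
    exact ⟨f, hf, fun x hx => h x (hst hx)⟩
  · rintro s t ⟨f, hf, hs⟩ ⟨g, hg, ht⟩
    refine ⟨⟨fun x => |f x| + |g x|, by fun_prop⟩, ?_, ?_⟩
    · refine hp.superset _ (hp.inter _ hf _ hg) _ ⟨_, rfl⟩ ?_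
      rintro x ⟨hx, hx'⟩
      have hx : f x = 0 := hx
      have hx' : g x = 0 := hx'
      simp [hx, hx']
    · intro x hx
      refine le_trans ?_ (le_abs_self _)
      change 1 ≤ |f x| + |g x|
      rcases hx with hx | hx
      · linarith [hs x hx, abs_nonneg (g x)]
      · linarith [ht x hx, abs_nonneg (f x)]
  · intro k _
    obtain ⟨Z, hZ, hkZ⟩ : ∃ Z ∈ p, k ∉ Z := by
      by_contra! h
      exact hfree ⟨k, h⟩
    obtain ⟨f, rfl⟩ := hp.zset Z hZ
    have hk : f k ≠ 0 := hkZ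
    refine ⟨{x | |f k| / 2 < |f x|}, ?_, ⟨fun x => f x * (2 / f k), by fun_prop⟩, ?_, ?_⟩
    · refine mem_nhdsWithin_of_mem_nhds (IsOpen.mem_nhds ?_ ?_)
      · exact isOpen_lt (by fun_prop) (by fun_prop)
      · exact half_lt_self (abs_pos.2 hk)
    · simpa [hk] using hZ
    · intro x hx
      have hx : |f k| / 2 < |f x| := hx
      have hk' := abs_pos.2 hk
      change 1 ≤ |f x * (2 / f k)|
      rw [abs_mul, abs_div, abs_two, mul_div_assoc', le_div_iff₀ hk']
      linarith

/-- A free `z`-ultrafilter which contains all zero sets that include a hard set is an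
`hz`-ultrafilter. -/
theorem IsZUltrafilter.isHZUltrafilter_of_forall_superset {p : Set (Set X)}
    (hp : IsZUltrafilter p) (hfree : ¬ IsFixedFamily p) {H : Set X} (hH : IsHard H)
    (h : ∀ Z, IsZSet Z → H ⊆ Z → Z ∈ p) : IsHZUltrafilter p := by
  obtain ⟨-, K, hK, hV⟩ := hH
  obtain ⟨f, hf, hfK⟩ := hp.1.exists_one_le_of_isCompact hfree hK
  -- Any threshold strictly between 0 and 1 works: the neighbourhood contains `K`, and its closed
  -- version still misses the member `{f = 0}` of `p`.
  obtain ⟨P, hP, u, hu, hu0, hu1⟩ := hV {x | 1 / 2 < |f x|}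
    (isOpen_lt (by fun_prop) (by fun_prop)) fun x hx => by
      have := hfK x hx
      change (1 / 2 : ℝ) < |f x|
      linarith
  have hA : IsZSet {x | 1 / 2 ≤ |f x|} := isZSet_ge ⟨fun x => |f x|, by fun_prop⟩ (1 / 2)
  have hu' : IsZSet {x | u x = 0} := ⟨u, rfl⟩
  have hmem : {x | 1 / 2 ≤ |f x|} ∪ {x | u x = 0} ∈ p := by
    refine h _ (hA.union hu') fun x hx => ?_
    by_cases hxf : 1 / 2 ≤ |f x|
    · exact Or.inl hxf
    · exact Or.inr (hu0 x ⟨hx, fun hx' => hxf (le_of_lt hx')⟩)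
  rcases hp.union_mem hA hu' hmem with hA' | hu''
  · refine (hp.1.empty_notMem ?_).elim
    convert hp.1.inter _ hf _ hA'
    symm
    rw [Set.eq_empty_iff_forall_notMem]
    rintro x ⟨hx, hx'⟩
    have hx : f x = 0 := hx
    have hx' : 1 / 2 ≤ |f x| := hx'
    rw [hx, abs_zero] at hx'
    linarith
  -- `{u = 0}` is completely separated from `Pᶜ` outright, so the empty compact set witnesses
  -- hardness.
  · exact hp.isHZUltrafilter hu'' ⟨hu'.isClosed, ∅, isCompact_empty,
      fun V _ _ => ⟨P, hP, u, hu, fun x hx => hx.1, hu1⟩⟩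

theorem isH2pc_of_compactSpace {T : Type v} [TopologicalSpace T] [CompactSpace T] {f : X → T}
    (hf : Continuous f) : IsH2pc f :=
  ⟨hf, fun _ _ => isClosed_closure.isCompact⟩

end Hard

/-! ### Topology of `δX`, extension of h2pc maps, and compactness. -/

namespace NPDelta

variable {X : Type u} [TopologicalSpace X]

theorem isZUltrafilter (p : NPDelta X) : IsZUltrafilter p.1 :=
  p.2.elim And.left IsHZUltrafilter.isZUltrafilter

theorem isClosed_basicClosed {Z : Set X} (hZ : IsZSet Z) :
    IsClosed (basicClosed Z : Set (NPDelta X)) :=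
  ⟨TopologicalSpace.isOpen_generateFrom_of_mem ⟨Z, hZ, rfl⟩⟩

theorem isTopologicalBasis : TopologicalSpace.IsTopologicalBasis
    {U : Set (NPDelta X) | ∃ Z : Set X, IsZSet Z ∧ U = (basicClosed Z)ᶜ} where
  exists_subset_inter := by
    rintro _ ⟨Z, hZ, rfl⟩ _ ⟨W, hW, rfl⟩ p ⟨hpZ, hpW⟩
    refine ⟨_, ⟨Z ∪ W, hZ.union hW, rfl⟩, ?_, ?_⟩
    · exact fun h => (p.isZUltrafilter.union_mem hZ hW h).elim hpZ hpW
    · intro q hq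
      exact ⟨fun h => hq (q.isZUltrafilter.1.superset Z h _ (hZ.union hW) Set.subset_union_left),
        fun h => hq (q.isZUltrafilter.1.superset W h _ (hZ.union hW) Set.subset_union_right)⟩
  sUnion_eq := by
    refine Set.eq_univ_of_forall fun p => ?_
    exact ⟨_, ⟨∅, isZSet_empty, rfl⟩, p.isZUltrafilter.1.empty_notMem⟩
  eq_generateFrom := rfl

theorem hasBasis_nhds (p : NPDelta X) :
    (𝓝 p).HasBasis (fun Z : Set X => IsZSet Z ∧ Z ∉ p.1) fun Z => (basicClosed Z)ᶜ := by
  refine ⟨fun s => ?_⟩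
  rw [isTopologicalBasis.mem_nhds_iff]
  constructor
  · rintro ⟨_, ⟨Z, hZ, rfl⟩, hp, hs⟩
    exact ⟨Z, ⟨hZ, hp⟩, hs⟩
  · rintro ⟨Z, ⟨hZ, hp⟩, hs⟩
    exact ⟨_, ⟨Z, hZ, rfl⟩, hp, hs⟩

theorem incl_mem_basicClosed {Z : Set X} (hZ : IsZSet Z) {x : X} :
    incl x ∈ basicClosed Z ↔ x ∈ Z :=
  ⟨And.right, fun h => ⟨hZ, h⟩⟩

theorem closure_incl_image {Z : Set X} (hZ : IsZSet Z) :
    closure (incl '' Z) = basicClosed Z := by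
  refine subset_antisymm (closure_minimal ?_ (isClosed_basicClosed hZ)) fun p hp => ?_
  · rintro _ ⟨x, hx, rfl⟩
    exact (incl_mem_basicClosed hZ).2 hx
  · rw [mem_closure_iff_nhds_basis (hasBasis_nhds p)]
    rintro W ⟨hW, hWp⟩
    have hZW : ¬ Z ⊆ W := fun h => hWp (p.isZUltrafilter.1.superset Z hp W hW h)
    obtain ⟨x, hxZ, hxW⟩ := Set.not_subset.1 hZW
    exact ⟨incl x, ⟨x, hxZ, rfl⟩, fun h => hxW h.2⟩

theorem denseRange_incl : DenseRange (incl : X → NPDelta X) := by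
  intro p
  rw [← Set.image_univ, closure_incl_image isZSet_univ]
  exact p.isZUltrafilter.1.univ_mem

theorem hasBasis_comap_incl (p : NPDelta X) :
    (comap incl (𝓝 p)).HasBasis (fun Z : Set X => IsZSet Z ∧ Z ∉ p.1) fun Z => Zᶜ := by
  refine ((hasBasis_nhds p).comap incl).congr (fun _ => Iff.rfl) fun Z hZ => ?_
  ext x
  exact not_congr (incl_mem_basicClosed hZ.1)

theorem isInducing_incl [CompletelyRegularSpace X] : IsInducing (incl : X → NPDelta X) := by
  refine isInducing_iff_nhds.2 fun x => ?_
  ext s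
  rw [(hasBasis_comap_incl (incl x)).mem_iff]
  constructor
  · intro hs
    obtain ⟨U, hUs, hU, hx⟩ := mem_nhds_iff.1 hs
    obtain ⟨Z, hZ, hxZ, hZU⟩ := exists_isZSet_of_isOpen hU hx
    exact ⟨Z, ⟨hZ, fun h => hxZ h.2⟩, hZU.trans hUs⟩
  · rintro ⟨Z, ⟨hZ, hxZ⟩, hs⟩
    exact mem_of_superset (hZ.isClosed.isOpen_compl.mem_nhds fun h => hxZ ⟨hZ, h⟩) hs

theorem isDenseInducing_incl [CompletelyRegularSpace X] :
    IsDenseInducing (incl : X → NPDelta X) :=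
  ⟨isInducing_incl, denseRange_incl⟩

/-- Supplies only a candidate limit, along one ultrafilter refining `p`. -/
theorem exists_ultrafilter_tendsto {T : Type v} [TopologicalSpace T] {f : X → T} (hf : IsH2pc f)
    (p : NPDelta X) : ∃ (𝒰 : Ultrafilter X) (t : T), (∀ Z ∈ p.1, Z ∈ 𝒰) ∧ Tendsto f 𝒰 (𝓝 t) := by
  rcases p.2 with ⟨-, x, hx⟩ | hp
  · refine ⟨pure x, f x, fun Z hZ => hx Z hZ, ?_⟩
    exact tendsto_pure_nhds f x
  · obtain ⟨H, hH, hard⟩ := hp.exists_isHard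
    obtain ⟨𝒰, h𝒰⟩ := p.isZUltrafilter.1.exists_ultrafilter
    obtain ⟨t, -, ht⟩ := (hf.2 H hard).ultrafilter_le_nhds (𝒰.map f) (by
      rw [le_principal_iff]
      exact Filter.mem_map.2 (mem_of_superset (h𝒰 H hH) fun x hx => subset_closure ⟨x, hx, rfl⟩))
    exact ⟨𝒰, t, h𝒰, ht⟩

theorem exists_tendsto_comap_incl {T : Type v} [TopologicalSpace T] [CompletelyRegularSpace T]
    {f : X → T} (hf : IsH2pc f) (p : NPDelta X) :
    ∃ t, Tendsto f (comap incl (𝓝 p)) (𝓝 t) := by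
  obtain ⟨𝒰, t, h𝒰, ht⟩ := exists_ultrafilter_tendsto hf p
  refine ⟨t, fun s hs => ?_⟩
  obtain ⟨U, hUs, hU, htU⟩ := mem_nhds_iff.1 hs
  obtain ⟨Z, ⟨g, rfl⟩, htZ, hZU⟩ := exists_isZSet_of_isOpen hU htU
  -- The pulled-back zero set cannot belong to `p`: `𝒰` would contain it along with its complement,
  -- a preimage of a neighbourhood of `t`.
  refine (hasBasis_comap_incl p).mem_iff.2 ⟨f ⁻¹' {y | g y = 0}, ⟨?_, fun h => ?_⟩, ?_⟩
  · exact ⟨g.comp ⟨f, hf.1⟩, rfl⟩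
  · have h1 := h𝒰 _ h
    have h2 : f ⁻¹' {y | g y = 0}ᶜ ∈ (𝒰 : Filter X) :=
      ht ((isClosed_eq g.continuous continuous_const).isOpen_compl.mem_nhds htZ)
    exact Ultrafilter.compl_notMem_iff.2 h1 h2
  · exact fun x hx => hUs (hZU hx)

/-- Every h2pc map into a Tychonoff space extends continuously over `δX`. -/
theorem exists_continuous_extension [CompletelyRegularSpace X] {T : Type v} [TopologicalSpace T]
    [T35Space T] {f : X → T} (hf : IsH2pc f) :
    ∃ g : NPDelta X → T, Continuous g ∧ ∀ x, g (incl x) = f x :=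
  ⟨isDenseInducing_incl.extend f,
    isDenseInducing_incl.continuous_extend (exists_tendsto_comap_incl hf),
    isDenseInducing_incl.extend_eq hf.1⟩

instance : T0Space (NPDelta X) where
  t0 := by
    intro p q h
    refine Subtype.ext (Set.ext fun Z => ?_)
    constructor
    · intro hZ
      exact (h.mem_closed_iff (isClosed_basicClosed (p.isZUltrafilter.1.zset Z hZ))).1 hZ
    · intro hZ
      exact (h.mem_closed_iff (isClosed_basicClosed (q.isZUltrafilter.1.zset Z hZ))).2 hZ

theorem continuous_eq_of_mem_basicClosed {T : Type v} [TopologicalSpace T] [T2Space T]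
    {g : NPDelta X → T} (hg : Continuous g) {Z : Set X} (hZ : IsZSet Z) {t : T}
    (h : ∀ x ∈ Z, g (incl x) = t) {p : NPDelta X} (hp : p ∈ basicClosed Z) : g p = t := by
  rw [← closure_incl_image hZ] at hp
  refine closure_minimal ?_ (isClosed_eq hg continuous_const) hp
  rintro _ ⟨x, hx, rfl⟩
  exact h x hx

instance [CompletelyRegularSpace X] : CompletelyRegularSpace (NPDelta X) where
  completely_regular := by
    intro p C hC hp
    obtain ⟨Z, ⟨hZ, hZp⟩, hZC⟩ := (hasBasis_nhds p).mem_iff.1 (hC.isOpen_compl.mem_nhds hp)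
    obtain ⟨W, hW, hWZ⟩ := p.isZUltrafilter.exists_disjoint hZ hZp
    have hW' := p.isZUltrafilter.1.zset W hW
    obtain ⟨f, hf, hf0, hf1⟩ := hW'.areCompletelySeparated hZ hWZ
    -- Maps into a compact space are h2pc, so the separating function extends.
    obtain ⟨g, hg, hgf⟩ := exists_continuous_extension (T := unitInterval)
      (f := fun x => ⟨f x, hf x⟩) (isH2pc_of_compactSpace (by fun_prop))
    refine ⟨g, hg, ?_, fun q hq => ?_⟩
    · exact continuous_eq_of_mem_basicClosed hg hW'
        (fun x hx => by rw [hgf]; exact Subtype.ext (hf0 x hx)) hW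
    · refine continuous_eq_of_mem_basicClosed hg hZ
        (fun x hx => by rw [hgf]; exact Subtype.ext (hf1 x hx)) ?_
      by_contra h
      exact hZC h hq

instance [CompletelyRegularSpace X] : T35Space (NPDelta X) where

/-- Hard sets of `X` have compact closure in `δX`. -/
theorem isCompact_closure_incl_image {H : Set X} (hH : IsHard H) :
    IsCompact (closure (incl '' H)) := by
  rw [isCompact_iff_ultrafilter_le_nhds]
  intro 𝒰 h𝒰
  rw [le_principal_iff] at h𝒰
  have hq : IsZFilter {Z : Set X | IsZSet Z ∧ basicClosed Z ∈ 𝒰} := by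
    refine ⟨fun Z hZ => hZ.1, ⟨Set.univ, isZSet_univ, ?_⟩, ?_, ?_, ?_⟩
    · exact univ_mem' fun p => p.isZUltrafilter.1.univ_mem
    · rintro ⟨-, h⟩
      obtain ⟨p, hp⟩ := 𝒰.nonempty_of_mem h
      exact p.isZUltrafilter.1.empty_notMem hp
    · rintro Z ⟨hZ, hZ𝒰⟩ W ⟨hW, hW𝒰⟩
      exact ⟨hZ.inter hW, mem_of_superset (inter_mem hZ𝒰 hW𝒰) fun p hp =>
        p.isZUltrafilter.1.inter Z hp.1 W hp.2⟩
    · rintro Z ⟨-, hZ𝒰⟩ W hW hZW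
      exact ⟨hW, mem_of_superset hZ𝒰 fun p hp => p.isZUltrafilter.1.superset Z hp W hW hZW⟩
  obtain ⟨p, hqp, hp⟩ := hq.exists_le_isZUltrafilter
  have hHp : ∀ Z, IsZSet Z → H ⊆ Z → Z ∈ p := fun Z hZ hHZ => hqp
    ⟨hZ, mem_of_superset h𝒰 (closure_incl_image hZ ▸ closure_mono (Set.image_mono hHZ))⟩
  have hpδ : (IsZUltrafilter p ∧ IsFixedFamily p) ∨ IsHZUltrafilter p := by
    by_cases hfix : IsFixedFamily p
    · exact Or.inl ⟨hp, hfix⟩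
    · exact Or.inr (hp.isHZUltrafilter_of_forall_superset hfix hH hHp)
  have hle : (𝒰 : Filter (NPDelta X)) ≤ 𝓝 ⟨p, hpδ⟩ := by
    -- A zero set outside `p` is outside the smaller trace filter too, so `𝒰` contains the
    -- complement of its basic closed set.
    refine (hasBasis_nhds _).ge_iff.2 fun Z hZ => ?_
    exact Ultrafilter.compl_mem_iff_notMem.2 fun h => hZ.2 (hqp ⟨hZ.1, h⟩)
  exact ⟨_, isClosed_closure.mem_of_tendsto hle h𝒰, hle⟩

theorem isH2pc_incl [CompletelyRegularSpace X] : IsH2pc (incl : X → NPDelta X) :=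
  ⟨isInducing_incl.continuous, fun _ hH => isCompact_closure_incl_image hH⟩

end NPDelta

theorem mainTheorem3 {X : Type u} [TopologicalSpace X] [T35Space X]
    {Y : Type v} [TopologicalSpace Y] [T35Space Y]
    (i : X → Y) (hi : Topology.IsEmbedding i) (hd : DenseRange i)
    (hext : ∀ (T : Type u) [TopologicalSpace T] [T35Space T] (f : X → T), IsH2pc f →
      ∃ g : Y → T, Continuous g ∧ ∀ x, g (i x) = f x)
    (hcpt : ∀ H : Set X, IsHard H → IsCompact (closure (i '' H))) :
    ∃ h : Y ≃ₜ NPDelta X, ∀ x, h (i x) = NPDelta.incl x := by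
  obtain ⟨g, hg, hgi⟩ := hext (NPDelta X) NPDelta.incl NPDelta.isH2pc_incl
  -- `hcpt` says precisely that `i` is h2pc.
  obtain ⟨k, hk, hki⟩ := NPDelta.exists_continuous_extension (f := i) ⟨hi.continuous, hcpt⟩
  have hkg : k ∘ g = id := hd.equalizer (hk.comp hg) continuous_id
    (funext fun x => by simp [hgi, hki])
  have hgk : g ∘ k = id := NPDelta.denseRange_incl.equalizer (hg.comp hk) continuous_id
    (funext fun x => by simp [hgi, hki])
  exact ⟨⟨⟨g, k, congrFun hkg, congrFun hgk⟩, hg, hk⟩, hgi⟩
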